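/- Fix the following conventions. An $n$-qubit stabilizer code is the joint $+1$-eigenspace $\mathcal C\subseteq(\mathbb C^2)^{\otimes n}$ of a commutative subgroup $S$ of the $n$-qubit Pauli group with $-1\notin S$; it is assumed that $\dim\mathcal C\ge 2$, and its distance is the least weight of a Pauli operator that commutes with $S$ but does not lie in $S$ up to a phase. A transversal operator is a tensor product of $n$ single-qubit unitaries. The first level of the Clifford hierarchy consists of the Pauli operators (up to a global phase); a unitary $U$ is in level $j+1$ if $UPU^\dagger$ is in level $j$ for every Pauli operator $P$; Clifford operators are those in level $2$. Logical qubits are chosen so that the logical Pauli operators are implemented by physical Pauli operators. Let $\tilde V_S = V_1\big(\bigotimes_{l=1}^n e^{-i2\pi a_l Z_l/D}\big)V_2$ be a logical gate (that is, $\tilde V_S\mathcal C\subseteq\mathcal C$) for an $n$-qubit stabilizer code $\mathcal C$ of distance at least $2$, where $D$ is a power of two, the $a_l$ are integers, and $V_1,V_2$ are transversal Clifford operators. Suppose that $\max_l|a_l| = O(\mathrm{poly}(n))$. Then: (i) if the diagonal factor $\bigotimes_{l} e^{-i2\pi a_l Z_l/D}$ acts non-trivially (not as a multiple of the identity) on the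 code space $V_2\mathcal C$, then $D = O(\mathrm{poly}(n))$; (ii) in every case, $\tilde V_S$ implements a logical gate $\tilde V_L$ in the $O(\log n)$-th level of the Clifford hierarchy. The implied polynomial and constant depend only on the polynomial that bounds the $|a_l|$, not on the code or the gate. -/

import Mathlib

open scoped Matrix

noncomputable section

/-- Computational basis states of `n` qubits. -/
abbrev QBits (n : ℕ) : Type := Fin n → Fin 2

/-- Operators on the Hilbert space of `n` qubits, written in the computational basis. -/
abbrev QOp (n : ℕ) : Type := Matrix (QBits n) (QBits n) ℂ

/-- The tensor product `u 0 ⊗ u 1 ⊗ ⋯` of one single-qubit operator per qubit. -/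
def tensorOp {n : ℕ} (u : Fin n → Matrix (Fin 2) (Fin 2) ℂ) : QOp n :=
  Matrix.of fun x y => ∏ l, u l (x l) (y l)

/-- Labels of the four single-qubit Pauli operators. -/
inductive PauliOp : Type
  | I
  | X
  | Y
  | Z
  deriving DecidableEq

/-- The matrices of the single-qubit Pauli operators. -/
def PauliOp.mat : PauliOp → Matrix (Fin 2) (Fin 2) ℂ
  | .I => 1
  | .X => !![0, 1; 1, 0]
  | .Y => !![0, -Complex.I; Complex.I, 0]
  | .Z => !![1, 0; 0, -1]

/-- Tensor products of Pauli operators on `n` qubits (without a phase). -/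
abbrev PauliString (n : ℕ) : Type := Fin n → PauliOp

/-- The operator of a Pauli string. -/
def PauliString.op {n : ℕ} (p : PauliString n) : QOp n :=
  tensorOp fun l => (p l).mat

/-- The weight: the number of qubits on which a Pauli string is not the identity. -/
def PauliString.weight {n : ℕ} (p : PauliString n) : ℕ :=
  (Finset.univ.filter fun l => p l ≠ PauliOp.I).card

/-- Membership in the `n`-qubit Pauli group: a Pauli string times a phase in `{1, i, -1, -i}`. -/
def InPauliGroup {n : ℕ} (M : QOp n) : Prop :=
  ∃ c : ℂ, c ^ 4 = 1 ∧ ∃ p : PauliString n, M = c • p.op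

/-- `InCliffordLevel j U`: the `n`-qubit operator `U` lies in the `j`-th level of the Clifford
hierarchy. The first level consists of the Pauli operators (up to a global phase), and `U` is in
level `j + 1` if it is unitary and `U P U†` is in level `j` for all Pauli operators `P`.
There is no level zero. -/
def InCliffordLevel {n : ℕ} : ℕ → QOp n → Prop
  | 0, _ => False
  | 1, U => ∃ c : ℂ, ‖c‖ = 1 ∧ ∃ p : PauliString n, U = c • p.op
  | j + 2, U => U ∈ Matrix.unitaryGroup (QBits n) ℂ ∧
      ∀ p : PauliString n, InCliffordLevel (j + 1) (U * p.op * Uᴴ)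

/-- Clifford operators: unitaries that map Pauli operators to Pauli operators by conjugation. -/
def IsClifford {n : ℕ} (U : QOp n) : Prop := InCliffordLevel 2 U

/-- Transversal operators: tensor products of single-qubit unitaries. -/
def IsTransversal {n : ℕ} (V : QOp n) : Prop :=
  ∃ u : Fin n → Matrix (Fin 2) (Fin 2) ℂ,
    (∀ l, u l ∈ Matrix.unitaryGroup (Fin 2) ℂ) ∧ V = tensorOp u

/-- The single-qubit rotation `exp(-i 2π a Z / D)`. -/
def zRotation (a : ℤ) (D : ℕ) : Matrix (Fin 2) (Fin 2) ℂ :=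
  NormedSpace.exp ((-Complex.I * 2 * Real.pi * a / D) • PauliOp.Z.mat)

/-- The operator `⊗_l exp(-i 2π a_l Z_l / D)`. -/
def zRotations {n : ℕ} (a : Fin n → ℤ) (D : ℕ) : QOp n :=
  tensorOp fun l => zRotation (a l) D

/-- An `n`-qubit stabilizer code, given by its stabilizer: a commutative subgroup of the Pauli
group that does not contain `-1`. -/
structure StabilizerCode (n : ℕ) where
  stabilizer : Subgroup (Matrix.unitaryGroup (QBits n) ℂ)
  pauli : ∀ g ∈ stabilizer, InPauliGroup (g : QOp n)
  comm : ∀ g ∈ stabilizer, ∀ h ∈ stabilizer, g * h = h * g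
  neg_one : ∀ g ∈ stabilizer, (g : QOp n) ≠ -1

namespace StabilizerCode

variable {n : ℕ}

/-- The code space: the common `+1`-eigenspace of the stabilizer. -/
def space (C : StabilizerCode n) : Submodule ℂ (QBits n → ℂ) where
  carrier := {v | ∀ g ∈ C.stabilizer, (g : QOp n) *ᵥ v = v}
  zero_mem' := fun g _ => Matrix.mulVec_zero _
  add_mem' := fun {v w} hv hw g hg => by rw [Matrix.mulVec_add, hv g hg, hw g hg]
  smul_mem' := fun c v hv g hg => by rw [Matrix.mulVec_smul, hv g hg]

/-- The distance: the least weight of a Pauli operator that commutes with the stabilizer but is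
not, up to a phase, an element of the stabilizer. -/
def distance (C : StabilizerCode n) : ℕ∞ :=
  sInf {w | ∃ p : PauliString n, (∀ g ∈ C.stabilizer, (g : QOp n) * p.op = p.op * (g : QOp n)) ∧
    (∀ g ∈ C.stabilizer, ∀ c : ℂ, p.op ≠ c • (g : QOp n)) ∧ w = (p.weight : ℕ∞)}

/-- `V` is a logical gate for the code: a unitary that maps the code space into itself. -/
def IsLogicalGate (C : StabilizerCode n) (V : QOp n) : Prop :=
  V ∈ Matrix.unitaryGroup (QBits n) ℂ ∧ ∀ v ∈ C.space, V *ᵥ v ∈ C.space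

/-- An encoding of `k` logical qubits into a stabilizer code: an isometry onto the code space for
which the logical Pauli operators are represented by elements of the physical Pauli group
(equivalently, a choice of logical Pauli operators in the normalizer of the stabilizer). -/
def IsEncoding (C : StabilizerCode n) {k : ℕ} (W : Matrix (QBits n) (QBits k) ℂ) : Prop :=
  Wᴴ * W = 1 ∧ LinearMap.range W.mulVecLin = C.space ∧
    ∀ q : PauliString k, ∃ P : QOp n, InPauliGroup P ∧ P * W = W * q.op

/-- With respect to the encoding `W`, the physical operator `V` implements the logical operator
`VL` on `k` qubits. -/
def Implements {k : ℕ} (W : Matrix (QBits n) (QBits k) ℂ) (V : QOp n) (VL : QOp k) : Prop :=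
  V * W = W * VL

end StabilizerCode

end

/-! ### Tensor products of single-qubit operators -/

/-! At a basis state `x` the diagonal factor has phase `exp(-2πi f(x)/D)`, where `f(x) = ∑ a_l
(-1)^{x_l}`. A logical gate commutes with the projector onto the code `C`, so conjugation by the
diagonal factor carries the projector onto `V₂ C` to the projector onto `V₁† C`. Conjugation by a
diagonal unitary does not change which entries vanish. Hence, if a transformed stabilizer element
links a state `x` in the support of `V₂ C` to `y`, some Pauli stabilizing `V₁† C` links them as
well. Pauli entries are fourth roots of unity, so the fourth powers of the phases at `x` and `y`
agree (`diagonal_pow_four`). Thus `D` divides `4 (f(x) - f(y))`, a number of size at most `8 n max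
|a_l|`. For larger `D`, `f` is invariant under the transformed stabilizer.

Now average `f` over the stabilizer, which changes the sign of qubit `l` by a character. A
nontrivial character averages to zero. A trivial one means that `Z_l` commutes with the transformed
stabilizer; as `V₂` is transversal and the distance is at least two, `Z_l` is then a scalar on `V₂
C`. So `f` is constant on the support and the diagonal factor acts as a scalar (`sum_bitSign_eq`,
`zRotations_trivial`). This is the contrapositive of (i).

For (ii), conjugating a Pauli by the rotations gives rotations with half the denominator times that
Pauli, so `D = 2 ^ m` lies in level `m + 2`. Clifford factors and the passage to logical operators
preserve levels. If the diagonal factor is a scalar on the code, the gate acts as a multiple of the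
Clifford `V₁ V₂`. -/

theorem tensorOp_apply {n : ℕ} (u : Fin n → Matrix (Fin 2) (Fin 2) ℂ) (x y : QBits n) :
    tensorOp u x y = ∏ l, u l (x l) (y l) := rfl

theorem tensorOp_mul {n : ℕ} (u v : Fin n → Matrix (Fin 2) (Fin 2) ℂ) :
    tensorOp u * tensorOp v = tensorOp fun l => u l * v l := by
  ext x y
  simp only [Matrix.mul_apply, tensorOp_apply, ← Finset.prod_mul_distrib]
  rw [Finset.prod_univ_sum]
  simp

theorem tensorOp_conjTranspose {n : ℕ} (u : Fin n → Matrix (Fin 2) (Fin 2) ℂ) :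
    (tensorOp u)ᴴ = tensorOp fun l => (u l)ᴴ := by
  ext x y
  simp [Matrix.conjTranspose_apply, tensorOp_apply]

theorem tensorOp_smul {n : ℕ} (c : Fin n → ℂ) (u : Fin n → Matrix (Fin 2) (Fin 2) ℂ) :
    (tensorOp fun l => c l • u l) = (∏ l, c l) • tensorOp u := by
  ext x y
  simp [tensorOp_apply, Finset.prod_mul_distrib]

theorem tensorOp_diagonal {n : ℕ} (d : Fin n → Fin 2 → ℂ) :
    (tensorOp fun l => Matrix.diagonal (d l)) = Matrix.diagonal fun x => ∏ l, d l (x l) := by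
  ext x y
  rw [tensorOp_apply]
  by_cases h : x = y
  · subst h; simp
  · obtain ⟨l, hl⟩ := Function.ne_iff.1 h
    rw [Matrix.diagonal_apply_ne _ h]
    exact Finset.prod_eq_zero (Finset.mem_univ l) (Matrix.diagonal_apply_ne _ hl)

theorem tensorOp_one {n : ℕ} : (tensorOp fun _ : Fin n => 1) = 1 := by
  simpa using tensorOp_diagonal (n := n) fun _ _ => 1

theorem tensorOp_mem_unitaryGroup {n : ℕ} {u : Fin n → Matrix (Fin 2) (Fin 2) ℂ}
    (hu : ∀ l, u l ∈ Matrix.unitaryGroup (Fin 2) ℂ) :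
    tensorOp u ∈ Matrix.unitaryGroup (QBits n) ℂ := by
  rw [Matrix.mem_unitaryGroup_iff, Matrix.star_eq_conjTranspose, tensorOp_conjTranspose,
    tensorOp_mul, ← tensorOp_one]
  congr 1
  ext1 l
  exact Matrix.mem_unitaryGroup_iff.1 (hu l)

/-! ### Pauli operators -/

theorem PauliOp.mat_mul_self (p : PauliOp) : p.mat * p.mat = 1 := by
  cases p <;> simp [PauliOp.mat, Matrix.one_fin_two]

theorem PauliOp.mat_conjTranspose (p : PauliOp) : p.matᴴ = p.mat := by
  cases p <;> ext i j <;> fin_cases i <;> fin_cases j <;> simp [PauliOp.mat]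

theorem PauliOp.mat_mul_comm (p q : PauliOp) :
    ∃ e : ℂ, (e = 1 ∨ e = -1) ∧ p.mat * q.mat = e • (q.mat * p.mat) := by
  cases p <;> cases q <;>
    first
    | (refine ⟨1, Or.inl rfl, ?_⟩; simp [PauliOp.mat]; done)
    | (refine ⟨-1, Or.inr rfl, ?_⟩; simp [PauliOp.mat])

theorem PauliOp.mat_apply_pow_four (p : PauliOp) (i j : Fin 2) :
    p.mat i j = 0 ∨ p.mat i j ^ 4 = 1 := by
  cases p <;> fin_cases i <;> fin_cases j <;>
    simp [PauliOp.mat, Even.neg_pow (by decide : Even 4)]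

/-- The signs against `Z` and `X` can be prescribed freely, which lets a Pauli be reconstructed from
its commutation relations. -/
theorem PauliOp.exists_mul_comm {e d : ℂ} (he : e = 1 ∨ e = -1) (hd : d = 1 ∨ d = -1) :
    ∃ r : PauliOp, r.mat * PauliOp.Z.mat = e • (PauliOp.Z.mat * r.mat) ∧
      r.mat * PauliOp.X.mat = d • (PauliOp.X.mat * r.mat) := by
  rcases he with rfl | rfl <;> rcases hd with rfl | rfl
  · exact ⟨.I, by simp [PauliOp.mat], by simp [PauliOp.mat]⟩
  · exact ⟨.Z, by simp [PauliOp.mat], by simp [PauliOp.mat]⟩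
  · exact ⟨.X, by simp [PauliOp.mat], by simp [PauliOp.mat]⟩
  · exact ⟨.Y, by simp [PauliOp.mat], by simp [PauliOp.mat]⟩

theorem PauliOp.eq_I_of_commute {p : PauliOp} (hZ : p.mat * PauliOp.Z.mat = PauliOp.Z.mat * p.mat)
    (hX : p.mat * PauliOp.X.mat = PauliOp.X.mat * p.mat) : p = PauliOp.I := by
  have h3 := congrFun (congrFun hZ 0) 1
  have h4 := congrFun (congrFun hX 0) 1
  cases p with
  | I => rfl
  | X => norm_num [PauliOp.mat, Matrix.mul_apply, Complex.ext_iff] at h3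
  | Y => norm_num [PauliOp.mat, Matrix.mul_apply, Complex.ext_iff] at h3
  | Z => norm_num [PauliOp.mat, Matrix.mul_apply, Complex.ext_iff] at h4

namespace PauliString

variable {n : ℕ}

theorem op_mul_self (p : PauliString n) : p.op * p.op = 1 := by
  simp only [op, tensorOp_mul, PauliOp.mat_mul_self, tensorOp_one]

theorem op_conjTranspose (p : PauliString n) : p.opᴴ = p.op := by
  simp only [op, tensorOp_conjTranspose, PauliOp.mat_conjTranspose]

theorem op_mem_unitaryGroup (p : PauliString n) : p.op ∈ Matrix.unitaryGroup (QBits n) ℂ := by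
  rw [Matrix.mem_unitaryGroup_iff, Matrix.star_eq_conjTranspose, op_conjTranspose, op_mul_self]

theorem op_mul_comm (p q : PauliString n) :
    ∃ e : ℂ, (e = 1 ∨ e = -1) ∧ p.op * q.op = e • (q.op * p.op) := by
  choose e he h using fun l => PauliOp.mat_mul_comm (p l) (q l)
  refine ⟨∏ l, e l, ?_, ?_⟩
  · exact Finset.prod_induction e (fun z => z = 1 ∨ z = -1)
      (by rintro a b (rfl | rfl) (rfl | rfl) <;> simp) (by simp) fun l _ => he l
  · simp only [op, tensorOp_mul, h, tensorOp_smul]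

theorem op_apply_pow_four {p : PauliString n} {x y : QBits n} (h : p.op x y ≠ 0) :
    p.op x y ^ 4 = 1 := by
  rw [op, tensorOp_apply] at h ⊢
  rw [← Finset.prod_pow]
  refine Finset.prod_eq_one fun l hl => ?_
  exact ((p l).mat_apply_pow_four _ _).resolve_left (Finset.prod_ne_zero_iff.1 h l hl)

/-- The Pauli string acting by `r` on qubit `l` and trivially elsewhere. -/
def single (l : Fin n) (r : PauliOp) : PauliString n := Function.update (fun _ => PauliOp.I) l r

theorem single_self (l : Fin n) (r : PauliOp) : single l r l = r := by simp [single]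

theorem single_of_ne {l j : Fin n} (h : j ≠ l) (r : PauliOp) : single l r j = PauliOp.I := by
  simp [single, h]

/-- Commutation relations with a single-qubit operator can be checked on that qubit. -/
theorem op_mul_single {p : PauliString n} {l : Fin n} {r : PauliOp} {e : ℂ}
    (h : (p l).mat * r.mat = e • (r.mat * (p l).mat)) :
    p.op * (single l r).op = e • ((single l r).op * p.op) := by
  have h1 : (fun j => (p j).mat * (single l r j).mat) =
      fun j => (if j = l then e else 1) • ((single l r j).mat * (p j).mat) := by
    ext1 j
    by_cases hj : j = l
    · subst hj; simp [single_self, h]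
    · simp [single_of_ne hj, hj, PauliOp.mat]
  rw [op, op, tensorOp_mul, tensorOp_mul, h1, tensorOp_smul]
  simp

end PauliString

/-- The eigenvalue of `Z` on a computational basis state. -/
def bitSign (i : Fin 2) : ℤ := if i = 0 then 1 else -1

theorem bitSign_injective : Function.Injective bitSign := by decide

theorem PauliOp.mat_Z : PauliOp.Z.mat = Matrix.diagonal fun i => (bitSign i : ℂ) := by
  ext i j; fin_cases i <;> fin_cases j <;> simp [PauliOp.mat, bitSign]

theorem PauliString.single_Z_op {n : ℕ} (l : Fin n) :
    (PauliString.single l PauliOp.Z).op = Matrix.diagonal fun x => (bitSign (x l) : ℂ) := by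
  have h : (fun j => (PauliString.single l PauliOp.Z j).mat) =
      fun j => Matrix.diagonal fun i => if j = l then (bitSign i : ℂ) else 1 := by
    ext1 j
    by_cases hj : j = l
    · subst hj; simp [single_self, PauliOp.mat_Z]
    · simp [single_of_ne hj, hj, PauliOp.mat]
  rw [PauliString.op, h, tensorOp_diagonal]
  simp

/-- Flip the bit `l`. -/
def flipBit {n : ℕ} (l : Fin n) (x : QBits n) : QBits n := Function.update x l (1 - x l)

theorem PauliString.single_X_op_apply {n : ℕ} (l : Fin n) (x y : QBits n) :
    (PauliString.single l PauliOp.X).op x y = if y = flipBit l x then 1 else 0 := by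
  rw [PauliString.op, tensorOp_apply]
  have hX : ∀ i j : Fin 2, PauliOp.X.mat i j = if j = 1 - i then 1 else 0 := by
    intro i j; fin_cases i <;> fin_cases j <;> simp [PauliOp.mat]
  split_ifs with h
  · subst h
    refine Finset.prod_eq_one fun j _ => ?_
    by_cases hj : j = l
    · subst hj; simp [single_self, flipBit, hX]
    · rw [single_of_ne hj, flipBit, Function.update_of_ne hj]
      exact Matrix.one_apply_eq (x j)
  · obtain ⟨j, hj⟩ := Function.ne_iff.1 h
    refine Finset.prod_eq_zero (Finset.mem_univ j) ?_
    by_cases hjl : j = l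
    · subst hjl
      simp only [flipBit, Function.update_self] at hj
      rw [single_self, hX, if_neg hj]
    · simp only [flipBit, Function.update_of_ne hjl] at hj
      simp [single_of_ne hjl, PauliOp.mat, Ne.symm hj]

variable {n : ℕ}

/-! ### Operators commuting with the Pauli operators up to sign -/

/-- An operator that commutes with all single-qubit `X` and `Z` operators is a scalar. -/
theorem eq_smul_one_of_commute {M : QOp n}
    (hZ : ∀ l, M * (PauliString.single l PauliOp.Z).op = (PauliString.single l PauliOp.Z).op * M)
    (hX : ∀ l, M * (PauliString.single l PauliOp.X).op = (PauliString.single l PauliOp.X).op * M) :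
    M = M 0 0 • (1 : QOp n) := by
  have hdiag : ∀ x y, x ≠ y → M x y = 0 := by
    intro x y hxy
    obtain ⟨l, hl⟩ := Function.ne_iff.1 hxy
    have h := congrFun (congrFun (hZ l) x) y
    rw [PauliString.single_Z_op, Matrix.mul_diagonal, Matrix.diagonal_mul] at h
    have h2 : ((bitSign (y l) : ℂ) - bitSign (x l)) * M x y = 0 := by rw [sub_mul, ← h]; ring
    refine (mul_eq_zero.1 h2).resolve_left fun h3 => hl (bitSign_injective ?_)
    exact_mod_cast (sub_eq_zero.1 h3).symm
  have hflip : ∀ l x, M (flipBit l x) (flipBit l x) = M x x := by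
    intro l x
    have h := congrFun (congrFun (hX l) x) (flipBit l x)
    simp only [Matrix.mul_apply, PauliString.single_X_op_apply] at h
    simp only [mul_ite, mul_one, mul_zero, ite_mul, one_mul, zero_mul, Finset.sum_ite_eq',
      Finset.mem_univ, if_true] at h
    rw [← h, Finset.sum_eq_single x]
    · simp
    · intro z _ hz; rw [hdiag x z hz.symm]; simp
    · simp
  -- Every basis state reaches `0` by clearing its nonzero bits, all in `s`, one at a time.
  have hconst : ∀ (s : Finset (Fin n)) (x : QBits n), (∀ l ∉ s, x l = 0) → M x x = M 0 0 := by
    intro s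
    induction s using Finset.induction_on with
    | empty => intro x hx; rw [show x = 0 from funext fun l => hx l (by simp)]
    | insert l s hl ih =>
      intro x hx
      by_cases h0 : x l = 0
      · refine ih x fun j hj => ?_
        by_cases hjl : j = l
        · rw [hjl, h0]
        · exact hx j (by simp [hj, hjl])
      · rw [← hflip l x]
        refine ih _ fun j hj => ?_
        by_cases hjl : j = l
        · subst hjl
          simp only [flipBit, Function.update_self]
          omega
        · rw [flipBit, Function.update_of_ne hjl]
          exact hx j (by simp [hj, hjl])
  ext x y
  by_cases h : x = y
  · subst h; simp [hconst Finset.univ x (by simp)]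
  · simp [h, hdiag x y h]

theorem norm_eq_one_of_smul_mem_unitaryGroup {ι : Type*} [Fintype ι] [DecidableEq ι] [Nonempty ι]
    {c : ℂ} {M : Matrix ι ι ℂ} (hM : M ∈ Matrix.unitaryGroup ι ℂ)
    (h : c • M ∈ Matrix.unitaryGroup ι ℂ) : ‖c‖ = 1 := by
  rw [Matrix.mem_unitaryGroup_iff] at hM h
  rw [star_smul, smul_mul_smul_comm, hM] at h
  have i : ι := Classical.arbitrary ι
  have h1 := congrFun (congrFun h i) i
  simp only [Matrix.smul_apply, Matrix.one_apply_eq, smul_eq_mul, mul_one] at h1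
  rw [Complex.star_def, Complex.mul_conj, Complex.normSq_eq_norm_sq] at h1
  have h2 : ‖c‖ ^ 2 = 1 := by exact_mod_cast h1
  exact (pow_eq_one_iff_of_nonneg (norm_nonneg c) two_ne_zero).1 h2

theorem smul_mem_unitaryGroup {ι : Type*} [Fintype ι] [DecidableEq ι]
    {c : ℂ} (hc : ‖c‖ = 1) {M : Matrix ι ι ℂ} (hM : M ∈ Matrix.unitaryGroup ι ℂ) :
    c • M ∈ Matrix.unitaryGroup ι ℂ := by
  rw [Matrix.mem_unitaryGroup_iff] at hM ⊢
  rw [star_smul, smul_mul_smul_comm, hM, Complex.star_def, Complex.mul_conj,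
    Complex.normSq_eq_norm_sq, hc]
  simp

theorem conjTranspose_mem_unitaryGroup {ι : Type*} [Fintype ι] [DecidableEq ι]
    {M : Matrix ι ι ℂ} (hM : M ∈ Matrix.unitaryGroup ι ℂ) : Mᴴ ∈ Matrix.unitaryGroup ι ℂ :=
  Unitary.star_mem hM

/-- A unitary that commutes up to sign with every Pauli operator is a Pauli operator. -/
theorem inCliffordLevel_one_of_mul_comm {M : QOp n} (hM : M ∈ Matrix.unitaryGroup (QBits n) ℂ)
    (h : ∀ p : PauliString n, ∃ e : ℂ, (e = 1 ∨ e = -1) ∧ M * p.op = e • (p.op * M)) :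
    InCliffordLevel 1 M := by
  choose e he h using h
  -- `r` has the same signs as `M` against every single-qubit `Z` and `X`, so the product of the two
  -- commutes with all of these and is a scalar.
  choose r hrZ hrX using fun l => PauliOp.exists_mul_comm (he (PauliString.single l PauliOp.Z))
    (he (PauliString.single l PauliOp.X))
  let R : PauliString n := r
  have hcomm : ∀ q : PauliString n, R.op * q.op = e q • (q.op * R.op) →
      R.op * M * q.op = q.op * (R.op * M) := by
    intro q hq
    have hsq : e q * e q = 1 := by rcases he q with h | h <;> simp [h]
    rw [mul_assoc, h q, mul_smul_comm, ← mul_assoc, hq, smul_mul_assoc, smul_smul, hsq, one_smul,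
      mul_assoc]
  have hs := eq_smul_one_of_commute (M := R.op * M)
    (fun l => hcomm _ (PauliString.op_mul_single (hrZ l)))
    (fun l => hcomm _ (PauliString.op_mul_single (hrX l)))
  have hMR : M = (R.op * M) 0 0 • R.op := by
    calc M = R.op * (R.op * M) := by rw [← mul_assoc, PauliString.op_mul_self, one_mul]
      _ = _ := by rw [hs]; simp
  refine ⟨_, ?_, R, hMR⟩
  rw [hMR] at hM
  exact norm_eq_one_of_smul_mem_unitaryGroup R.op_mem_unitaryGroup hM

/-! ### The Clifford hierarchy -/

theorem mul_mul_conjTranspose_mem {U M : QOp n} (hU : U ∈ Matrix.unitaryGroup (QBits n) ℂ)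
    (hM : M ∈ Matrix.unitaryGroup (QBits n) ℂ) : U * M * Uᴴ ∈ Matrix.unitaryGroup (QBits n) ℂ :=
  mul_mem (mul_mem hU hM) (conjTranspose_mem_unitaryGroup hU)

theorem conjTranspose_mul_self_of_mem {ι : Type*} [Fintype ι] [DecidableEq ι]
    {U : Matrix ι ι ℂ} (hU : U ∈ Matrix.unitaryGroup ι ℂ) : Uᴴ * U = 1 :=
  Matrix.mem_unitaryGroup_iff'.1 hU

theorem mul_conjTranspose_self_of_mem {ι : Type*} [Fintype ι] [DecidableEq ι]
    {U : Matrix ι ι ℂ} (hU : U ∈ Matrix.unitaryGroup ι ℂ) : U * Uᴴ = 1 :=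
  Matrix.mem_unitaryGroup_iff.1 hU

theorem InCliffordLevel.mem_unitaryGroup {j : ℕ} {U : QOp n} (h : InCliffordLevel j U) :
    U ∈ Matrix.unitaryGroup (QBits n) ℂ := by
  match j, h with
  | 1, ⟨c, hc, p, hp⟩ => rw [hp]; exact smul_mem_unitaryGroup hc p.op_mem_unitaryGroup
  | _ + 2, h => exact h.1

theorem InCliffordLevel.smul {j : ℕ} {U : QOp n} (h : InCliffordLevel j U) {c : ℂ}
    (hc : ‖c‖ = 1) : InCliffordLevel j (c • U) := by
  match j, h with
  | 1, ⟨d, hd, p, hp⟩ => exact ⟨c * d, by simp [hc, hd], p, by rw [hp, smul_smul]⟩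
  | _ + 2, h =>
    refine ⟨smul_mem_unitaryGroup hc h.1, fun p => ?_⟩
    have h1 : c • U * p.op * (c • U)ᴴ = U * p.op * Uᴴ := by
      rw [Matrix.conjTranspose_smul, smul_mul_assoc, smul_mul_smul_comm, Complex.star_def,
        Complex.mul_conj, Complex.normSq_eq_norm_sq, hc]
      simp
    rw [h1]
    exact h.2 p

theorem InCliffordLevel.mul_op_comm {M : QOp n} (h : InCliffordLevel 1 M) (p : PauliString n) :
    ∃ e : ℂ, (e = 1 ∨ e = -1) ∧ M * p.op = e • (p.op * M) := by
  obtain ⟨c, -, q, rfl⟩ := h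
  obtain ⟨e, he, h⟩ := q.op_mul_comm p
  exact ⟨e, he, by rw [smul_mul_assoc, h, mul_smul_comm, smul_comm]⟩

/-- `V q V†` is a Pauli and commutes with `p` up to sign. Conjugating this relation by `V†` shows
that `V† p V` commutes up to sign with every `q`, which characterizes Paulis. -/
theorem IsClifford.conjTranspose {V : QOp n} (hV : IsClifford V) : IsClifford Vᴴ := by
  have hu := conjTranspose_mul_self_of_mem hV.1
  have hu' := mul_conjTranspose_self_of_mem hV.1
  refine ⟨conjTranspose_mem_unitaryGroup hV.1, fun p => inCliffordLevel_one_of_mul_comm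
    (mul_mul_conjTranspose_mem (conjTranspose_mem_unitaryGroup hV.1) p.op_mem_unitaryGroup)
    fun q => ?_⟩
  obtain ⟨e, he, h⟩ := InCliffordLevel.mul_op_comm (hV.2 q) p
  have hsq : e * e = 1 := by rcases he with h | h <;> simp [h]
  refine ⟨e, he, ?_⟩
  rw [Matrix.conjTranspose_conjTranspose]
  have h2 : Vᴴ * (V * q.op * Vᴴ * p.op) * V = e • (Vᴴ * (p.op * (V * q.op * Vᴴ)) * V) := by
    rw [h, mul_smul_comm, smul_mul_assoc]
  have h3 : Vᴴ * (V * q.op * Vᴴ * p.op) * V = q.op * (Vᴴ * p.op * V) := by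
    simp only [← mul_assoc, hu, one_mul]
  have h4 : Vᴴ * (p.op * (V * q.op * Vᴴ)) * V = Vᴴ * p.op * V * q.op := by
    simp only [mul_assoc, hu, mul_one]
  rw [h3, h4] at h2
  rw [h2, smul_smul, hsq, one_smul]

/-- The higher levels of the Clifford hierarchy are stable under multiplication by Clifford
operators. -/
theorem InCliffordLevel.clifford_mul_mul {V₁ V₂ : QOp n} (h₁ : IsClifford V₁) (h₂ : IsClifford V₂)
    {j : ℕ} {U : QOp n} (hU : InCliffordLevel (j + 2) U) :
    InCliffordLevel (j + 2) (V₁ * U * V₂) := by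
  induction j generalizing V₁ V₂ U with
  | zero =>
    refine ⟨mul_mem (mul_mem h₁.1 hU.1) h₂.1, fun p => ?_⟩
    obtain ⟨c, hc, q, hq⟩ := h₂.2 p
    obtain ⟨d, hd, r, hr⟩ := hU.2 q
    have : V₁ * U * V₂ * p.op * (V₁ * U * V₂)ᴴ = (c * d) • (V₁ * r.op * V₁ᴴ) := by
      calc _ = V₁ * (U * (V₂ * p.op * V₂ᴴ) * Uᴴ) * V₁ᴴ := by
            simp only [Matrix.conjTranspose_mul, mul_assoc]
        _ = _ := by rw [hq, mul_smul_comm, smul_mul_assoc, hr]; simp [smul_smul]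
    rw [this]
    exact InCliffordLevel.smul (h₁.2 r) (by simp [hc, hd])
  | succ j ih =>
    refine ⟨mul_mem (mul_mem h₁.1 hU.1) h₂.1, fun p => ?_⟩
    obtain ⟨c, hc, q, hq⟩ := h₂.2 p
    -- The conjugate is again of the form Clifford, lower level, Clifford, now with `V₁†` on the
    -- right; hence the induction over arbitrary Clifford factors.
    have : V₁ * U * V₂ * p.op * (V₁ * U * V₂)ᴴ = c • (V₁ * (U * q.op * Uᴴ) * V₁ᴴ) := by
      calc _ = V₁ * (U * (V₂ * p.op * V₂ᴴ) * Uᴴ) * V₁ᴴ := by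
            simp only [Matrix.conjTranspose_mul, mul_assoc]
        _ = _ := by rw [hq, mul_smul_comm, smul_mul_assoc]; simp
    rw [this]
    exact InCliffordLevel.smul (ih h₁ h₁.conjTranspose (hU.2 q)) hc

theorem PauliString.op_mul_op_mul_op (p q : PauliString n) :
    ∃ e : ℂ, (e = 1 ∨ e = -1) ∧ p.op * q.op * p.op = e • q.op := by
  obtain ⟨e, he, h⟩ := p.op_mul_comm q
  exact ⟨e, he, by rw [h, smul_mul_assoc, mul_assoc, p.op_mul_self, mul_one]⟩

theorem norm_eq_one_of_eq_or {e : ℂ} (he : e = 1 ∨ e = -1) : ‖e‖ = 1 := by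
  rcases he with rfl | rfl <;> simp

theorem PauliString.isClifford_op (p : PauliString n) : IsClifford p.op := by
  refine ⟨p.op_mem_unitaryGroup, fun q => ?_⟩
  obtain ⟨e, he, h⟩ := p.op_mul_op_mul_op q
  exact ⟨e, norm_eq_one_of_eq_or he, q, by rw [op_conjTranspose, h]⟩

theorem isClifford_one : IsClifford (1 : QOp n) :=
  ⟨one_mem _, fun q => ⟨1, by simp, q, by simp⟩⟩

theorem IsClifford.mul {V₁ V₂ : QOp n} (h₁ : IsClifford V₁) (h₂ : IsClifford V₂) :
    IsClifford (V₁ * V₂) := by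
  have h := InCliffordLevel.clifford_mul_mul (j := 0) h₁ h₂ isClifford_one
  rwa [mul_one] at h

/-! ### The diagonal rotations -/

/-- The diagonal entries of `zRotation a D`. -/
noncomputable def zPhase (a : ℤ) (D : ℕ) (i : Fin 2) : ℂ :=
  Complex.exp (-Complex.I * 2 * Real.pi * a / D * bitSign i)

theorem zRotation_eq_diagonal (a : ℤ) (D : ℕ) :
    zRotation a D = Matrix.diagonal (zPhase a D) := by
  rw [zRotation, PauliOp.mat_Z, ← Matrix.diagonal_smul, Matrix.exp_diagonal]
  congr 1
  ext i
  simp [zPhase, Pi.coe_exp, ← Complex.exp_eq_exp_ℂ]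

theorem zPhase_mul_conj (a : ℤ) (D : ℕ) (i : Fin 2) :
    zPhase a D i * star (zPhase a D i) = 1 := by
  rw [zPhase, Complex.star_def, ← Complex.exp_conj, ← Complex.exp_add]
  simp [map_ofNat, neg_div]

theorem zRotation_mem_unitaryGroup (a : ℤ) (D : ℕ) :
    zRotation a D ∈ Matrix.unitaryGroup (Fin 2) ℂ := by
  rw [Matrix.mem_unitaryGroup_iff, Matrix.star_eq_conjTranspose, zRotation_eq_diagonal,
    Matrix.diagonal_conjTranspose, Matrix.diagonal_mul_diagonal, ← Matrix.diagonal_one]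
  congr 1
  ext1 i
  exact zPhase_mul_conj a D i

theorem zRotations_mem_unitaryGroup (a : Fin n → ℤ) (D : ℕ) :
    zRotations a D ∈ Matrix.unitaryGroup (QBits n) ℂ :=
  tensorOp_mem_unitaryGroup fun l => zRotation_mem_unitaryGroup (a l) D

theorem zRotations_eq_diagonal (a : Fin n → ℤ) (D : ℕ) :
    zRotations a D = Matrix.diagonal fun x =>
      Complex.exp (-Complex.I * 2 * Real.pi / D * ((∑ l, a l * bitSign (x l) : ℤ) : ℂ)) := by
  simp only [zRotations, zRotation_eq_diagonal, tensorOp_diagonal, zPhase, ← Complex.exp_sum]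
  congr 1
  ext x
  congr 1
  push_cast
  rw [Finset.mul_sum]
  exact Finset.sum_congr rfl fun l _ => by ring

theorem zRotations_one (a : Fin n → ℤ) : zRotations a 1 = 1 := by
  rw [zRotations_eq_diagonal, ← Matrix.diagonal_one]
  congr 1
  ext x
  rw [Complex.exp_eq_one_iff]
  exact ⟨-∑ l, a l * bitSign (x l), by push_cast; ring⟩

/-- `I` and `Z` commute with the rotation `R`, giving `b = 0`. `X` and `Y` invert it, so `R P R† =
R² P`, and squaring halves the denominator, giving `b = a`. -/
theorem zRotation_conj_pauli (a : ℤ) {D : ℕ} (p : PauliOp) :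
    ∃ b : ℤ, zRotation a (2 * D) * p.mat * (zRotation a (2 * D))ᴴ = zRotation b D * p.mat := by
  have h0 : ∀ i, zPhase 0 D i = 1 := fun i => by simp [zPhase]
  have hexp : ∀ i j, bitSign j = - bitSign i →
      zPhase a (2 * D) i * star (zPhase a (2 * D) j) = zPhase a D i := by
    intro i j hij
    simp only [zPhase, Complex.star_def, ← Complex.exp_conj, ← Complex.exp_add, hij]
    congr 1
    simp only [map_mul, map_neg, map_div₀, Complex.conj_I, Complex.conj_ofReal, map_intCast,
      map_natCast, Int.cast_neg]
    simp only [map_ofNat, Nat.cast_mul, Nat.cast_ofNat]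
    rcases eq_or_ne (D : ℂ) 0 with h | h
    · simp [h]
    · field_simp; ring
  have hd := zPhase_mul_conj a (2 * D)
  have key : ∀ b : ℤ, (∀ i j, p.mat i j ≠ 0 →
      zPhase a (2 * D) i * star (zPhase a (2 * D) j) = zPhase b D i) →
      zRotation a (2 * D) * p.mat * (zRotation a (2 * D))ᴴ = zRotation b D * p.mat := by
    intro b hb
    ext i j
    rw [zRotation_eq_diagonal, zRotation_eq_diagonal, Matrix.diagonal_conjTranspose,
      Matrix.mul_diagonal, Matrix.diagonal_mul, Matrix.diagonal_mul, Pi.star_apply]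
    by_cases h : p.mat i j = 0
    · simp [h]
    · rw [← hb i j h]; ring
  have key0 : (∀ i j, p.mat i j ≠ 0 → i = j) →
      ∃ b : ℤ, zRotation a (2 * D) * p.mat * (zRotation a (2 * D))ᴴ = zRotation b D * p.mat :=
    fun h => ⟨0, key 0 fun i j hij => by rw [← h i j hij, hd, h0]⟩
  have key1 : (∀ i j, p.mat i j ≠ 0 → bitSign j = - bitSign i) →
      ∃ b : ℤ, zRotation a (2 * D) * p.mat * (zRotation a (2 * D))ᴴ = zRotation b D * p.mat :=
    fun h => ⟨a, key a fun i j hij => hexp i j (h i j hij)⟩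
  cases p
  · exact key0 (by intro i j; fin_cases i <;> fin_cases j <;> simp [PauliOp.mat])
  · exact key1 (by intro i j; fin_cases i <;> fin_cases j <;> simp [PauliOp.mat, bitSign])
  · exact key1 (by intro i j; fin_cases i <;> fin_cases j <;> simp [PauliOp.mat, bitSign])
  · exact key0 (by intro i j; fin_cases i <;> fin_cases j <;> simp [PauliOp.mat])

theorem zRotations_conj_pauli (a : Fin n → ℤ) {D : ℕ} (p : PauliString n) :
    ∃ b : Fin n → ℤ,
      zRotations a (2 * D) * p.op * (zRotations a (2 * D))ᴴ = zRotations b D * p.op := by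
  choose b hb using fun l => zRotation_conj_pauli (a l) (D := D) (p l)
  exact ⟨b, by simp only [zRotations, PauliString.op, tensorOp_conjTranspose, tensorOp_mul, hb]⟩

/-- The trailing Pauli makes the induction close, since conjugating `q` produces rotations times
`q`. At `D = 1` the rotations are trivial and a Pauli remains, placed in level 2. -/
theorem inCliffordLevel_zRotations_mul_op (m : ℕ) (a : Fin n → ℤ) (p : PauliString n) :
    InCliffordLevel (m + 2) (zRotations a (2 ^ m) * p.op) := by
  induction m generalizing a p with
  | zero =>
    rw [pow_zero, zRotations_one, one_mul]
    exact p.isClifford_op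
  | succ m ih =>
    refine ⟨mul_mem (zRotations_mem_unitaryGroup a _) p.op_mem_unitaryGroup, fun q => ?_⟩
    obtain ⟨e, he, h⟩ := p.op_mul_op_mul_op q
    obtain ⟨b, hb⟩ := zRotations_conj_pauli a (D := 2 ^ m) q
    rw [← pow_succ'] at hb
    have : zRotations a (2 ^ (m + 1)) * p.op * q.op * (zRotations a (2 ^ (m + 1)) * p.op)ᴴ =
        e • (zRotations b (2 ^ m) * q.op) := by
      rw [← hb, ← smul_mul_assoc, ← mul_smul_comm, ← h, Matrix.conjTranspose_mul,
        PauliString.op_conjTranspose]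
      simp only [mul_assoc]
    rw [this]
    exact (ih b q).smul (norm_eq_one_of_eq_or he)

theorem inCliffordLevel_zRotations (m : ℕ) (a : Fin n → ℤ) :
    InCliffordLevel (m + 2) (zRotations a (2 ^ m)) := by
  have h := inCliffordLevel_zRotations_mul_op m a fun _ => PauliOp.I
  rwa [show PauliString.op (fun _ : Fin n => PauliOp.I) = 1 from tensorOp_one, mul_one] at h

/-! ### Stabilizers -/

theorem smul_left_cancel_of_mem_unitaryGroup {M : QOp n}
    (hM : M ∈ Matrix.unitaryGroup (QBits n) ℂ) {c d : ℂ} (h : c • M = d • M) : c = d := by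
  have h1 : c • (M * star M) = d • (M * star M) := by
    rw [← smul_mul_assoc, h, smul_mul_assoc]
  rw [Matrix.mem_unitaryGroup_iff.1 hM] at h1
  simpa using congrFun (congrFun h1 0) 0

theorem PauliOp.mat_eq_of_ne_zero {p : PauliOp} {i j k : Fin 2} (hj : p.mat i j ≠ 0)
    (hk : p.mat i k ≠ 0) : j = k := by
  cases p <;> fin_cases i <;> fin_cases j <;> fin_cases k <;> simp_all [PauliOp.mat]

namespace InPauliGroup

theorem inCliffordLevel_one {M : QOp n} (h : InPauliGroup M) : InCliffordLevel 1 M := by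
  obtain ⟨c, hc, p, rfl⟩ := h
  exact ⟨c, (pow_eq_one_iff_of_nonneg (norm_nonneg c) four_ne_zero).1
    (by rw [← norm_pow, hc, norm_one]), p, rfl⟩

theorem apply_pow_four {M : QOp n} (h : InPauliGroup M) {x y : QBits n} (hxy : M x y ≠ 0) :
    M x y ^ 4 = 1 := by
  obtain ⟨c, hc, p, rfl⟩ := h
  rw [Matrix.smul_apply, smul_eq_mul] at hxy ⊢
  rw [mul_pow, hc, one_mul, PauliString.op_apply_pow_four (right_ne_zero_of_mul hxy)]

theorem eq_of_apply_ne_zero {M : QOp n} (h : InPauliGroup M) {x y z : QBits n} (hy : M x y ≠ 0)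
    (hz : M x z ≠ 0) : y = z := by
  obtain ⟨c, -, p, rfl⟩ := h
  rw [Matrix.smul_apply, smul_eq_mul] at hy hz
  have hy := right_ne_zero_of_mul hy
  have hz := right_ne_zero_of_mul hz
  rw [PauliString.op, tensorOp_apply, Finset.prod_ne_zero_iff] at hy hz
  exact funext fun l =>
    PauliOp.mat_eq_of_ne_zero (hy l (Finset.mem_univ l)) (hz l (Finset.mem_univ l))

/-- Pauli operators act on vectors as monomial matrices. -/
theorem mulVec_apply {M : QOp n} (h : InPauliGroup M) {x y : QBits n} (hxy : M x y ≠ 0)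
    (v : QBits n → ℂ) : (M *ᵥ v) x = M x y * v y := by
  rw [Matrix.mulVec, dotProduct, Finset.sum_eq_single y]
  · intro z _ hz
    rw [not_not.1 fun h0 => hz (h.eq_of_apply_ne_zero h0 hxy), zero_mul]
  · simp

/-- The hierarchy only bounds the phase `d` to norm one. Since Pauli strings square to `1`, so do
their conjugates, which forces `d * d = 1`. -/
theorem conj {V P : QOp n} (hV : IsClifford V) (hP : InPauliGroup P) :
    InPauliGroup (V * P * Vᴴ) := by
  obtain ⟨c, hc, p, rfl⟩ := hP
  obtain ⟨d, -, r, hr⟩ := hV.2 p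
  refine ⟨c * d, ?_, r, by rw [mul_smul_comm, smul_mul_assoc, hr, smul_smul]⟩
  have hsq : (d * d) • (1 : QOp n) = (1 : ℂ) • 1 := by
    calc (d * d) • (1 : QOp n) = (d • r.op) * (d • r.op) := by
          rw [smul_mul_smul_comm, r.op_mul_self]
      _ = V * (p.op * (Vᴴ * V) * p.op) * Vᴴ := by rw [← hr]; simp only [mul_assoc]
      _ = _ := by
          rw [conjTranspose_mul_self_of_mem hV.1, mul_one, p.op_mul_self, mul_one,
            mul_conjTranspose_self_of_mem hV.1, one_smul]
  have hd := smul_left_cancel_of_mem_unitaryGroup (one_mem _) hsq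
  calc (c * d) ^ 4 = c ^ 4 * (d * d) ^ 2 := by ring
    _ = 1 := by rw [hc, hd]; norm_num

end InPauliGroup

instance : Finite PauliOp :=
  Set.finite_univ_iff.1 ((Set.toFinite {.I, .X, .Y, .Z}).subset fun p _ => by cases p <;> simp)

theorem finite_setOf_inPauliGroup : {M : QOp n | InPauliGroup M}.Finite := by
  have h4 : {c : ℂ | c ^ 4 = 1}.Finite :=
    (Polynomial.nthRootsFinset 4 (1 : ℂ)).finite_toSet.subset fun c hc =>
      (Polynomial.mem_nthRootsFinset (by norm_num) 1).2 hc
  refine (h4.image2 (fun c (p : PauliString n) => c • p.op) Set.finite_univ).subset ?_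
  rintro M ⟨c, hc, p, rfl⟩
  exact ⟨c, hc, p, Set.mem_univ p, rfl⟩

/-! ### The code projector and the phases of diagonal factors -/

namespace StabilizerCode

variable (C : StabilizerCode n)

instance : Finite C.stabilizer := by
  have := (finite_setOf_inPauliGroup (n := n)).to_subtype
  exact Finite.of_injective
    (fun g : C.stabilizer => (⟨_, C.pauli g g.2⟩ : {M : QOp n | InPauliGroup M}))
    fun g h hgh => Subtype.ext (Subtype.ext (Subtype.mk.inj hgh))

noncomputable instance : Fintype C.stabilizer := Fintype.ofFinite _

/-- The sum of the stabilizer elements: a multiple of the projector onto the code space. -/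
noncomputable def stabilizerSum : QOp n :=
  ∑ g : C.stabilizer, ((g : Matrix.unitaryGroup (QBits n) ℂ) : QOp n)

theorem mul_stabilizerSum {g : Matrix.unitaryGroup (QBits n) ℂ} (hg : g ∈ C.stabilizer) :
    (g : QOp n) * C.stabilizerSum = C.stabilizerSum := by
  rw [stabilizerSum, Finset.mul_sum]
  exact Fintype.sum_equiv (Equiv.mulLeft (⟨g, hg⟩ : C.stabilizer)) _ _ fun h => rfl

theorem stabilizerSum_mulVec_mem (v : QBits n → ℂ) : C.stabilizerSum *ᵥ v ∈ C.space :=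
  fun g hg => by rw [Matrix.mulVec_mulVec, C.mul_stabilizerSum hg]

theorem stabilizerSum_mulVec {v : QBits n → ℂ} (hv : v ∈ C.space) :
    C.stabilizerSum *ᵥ v = (Fintype.card C.stabilizer : ℂ) • v := by
  rw [stabilizerSum, Matrix.sum_mulVec, Finset.sum_congr rfl fun (g : C.stabilizer) _ => hv g.1 g.2]
  simp [Nat.cast_smul_eq_nsmul]

theorem stabilizerSum_mul {X : QOp n} (h : ∀ v, X *ᵥ v ∈ C.space) :
    C.stabilizerSum * X = (Fintype.card C.stabilizer : ℂ) • X :=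
  Matrix.ext_iff_mulVec.2 fun v => by
    rw [← Matrix.mulVec_mulVec, C.stabilizerSum_mulVec (h v), Matrix.smul_mulVec]

theorem stabilizerSum_conjTranspose : C.stabilizerSumᴴ = C.stabilizerSum := by
  rw [stabilizerSum, Matrix.conjTranspose_sum]
  exact Fintype.sum_equiv (Equiv.inv C.stabilizer) _ _ fun h => rfl

theorem card_stabilizer_ne_zero : (Fintype.card C.stabilizer : ℂ) ≠ 0 :=
  Nat.cast_ne_zero.2 Fintype.card_ne_zero

variable {C}

/-- By finite dimension the injective `V` maps the code space onto itself, so its inverse preserves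
the code space too. -/
theorem IsLogicalGate.conjTranspose {V : QOp n} (hV : C.IsLogicalGate V) : C.IsLogicalGate Vᴴ := by
  refine ⟨conjTranspose_mem_unitaryGroup hV.1, fun v hv => ?_⟩
  have hu := conjTranspose_mul_self_of_mem hV.1
  have hle : C.space.map V.mulVecLin ≤ C.space := by
    rintro _ ⟨w, hw, rfl⟩
    exact hV.2 w hw
  have hinj : Function.Injective V.mulVecLin := by
    refine Function.LeftInverse.injective (g := Vᴴ.mulVecLin) fun w => ?_
    simp [hu]
  have heq := Submodule.eq_of_le_of_finrank_eq hle
    (Submodule.equivMapOfInjective _ hinj C.space).finrank_eq.symm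
  rw [← heq] at hv
  obtain ⟨w, hw, rfl⟩ := hv
  simpa [hu] using hw

/-- With `Σ` the stabilizer sum and `N` its number of terms, invariance under `V` gives `Σ V Σ = N V
Σ`, and the adjoint of the same relation for `V†` gives `Σ V Σ = N Σ V`. -/
theorem IsLogicalGate.commute_stabilizerSum {V : QOp n} (hV : C.IsLogicalGate V) :
    V * C.stabilizerSum = C.stabilizerSum * V := by
  have h : ∀ {V : QOp n}, C.IsLogicalGate V → C.stabilizerSum * (V * C.stabilizerSum) =
      (Fintype.card C.stabilizer : ℂ) • (V * C.stabilizerSum) := fun hV =>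
    C.stabilizerSum_mul fun v => by
      rw [← Matrix.mulVec_mulVec]; exact hV.2 _ (C.stabilizerSum_mulVec_mem v)
  have h1 := h hV
  have h2 := congrArg Matrix.conjTranspose (h hV.conjTranspose)
  simp only [Matrix.conjTranspose_mul, Matrix.conjTranspose_smul, C.stabilizerSum_conjTranspose,
    Matrix.conjTranspose_conjTranspose, star_natCast] at h2
  rw [← mul_assoc, h2] at h1
  exact (smul_right_injective _ C.card_stabilizer_ne_zero h1).symm

/-- The projector onto the transformed code space has non-zero entries wherever a transformed
stabilizer element does, on the support of the transformed code space. -/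
theorem conj_stabilizerSum_apply_ne_zero {V : QOp n} (hV : IsClifford V)
    {g : Matrix.unitaryGroup (QBits n) ℂ} (hg : g ∈ C.stabilizer) {v : QBits n → ℂ}
    (hv : v ∈ C.space) {x y : QBits n} (hx : (V *ᵥ v) x ≠ 0)
    (hxy : (V * (g : QOp n) * Vᴴ) x y ≠ 0) :
    (V * C.stabilizerSum * Vᴴ) x y ≠ 0 := by
  have hu := conjTranspose_mul_self_of_mem hV.1
  set T := V * C.stabilizerSum * Vᴴ with hT
  set s := V * (g : QOp n) * Vᴴ with hs
  have hsP : InPauliGroup s := InPauliGroup.conj hV (C.pauli g hg)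
  have hsT : s * T = T := by
    calc s * T = V * ((g : QOp n) * (Vᴴ * V) * C.stabilizerSum) * Vᴴ := by
          simp only [hs, hT, mul_assoc]
      _ = T := by rw [hu, mul_one, C.mul_stabilizerSum hg]
  have hsv : s *ᵥ (V *ᵥ v) = V *ᵥ v := by
    rw [Matrix.mulVec_mulVec, hs, mul_assoc, hu, mul_one, ← Matrix.mulVec_mulVec, hv g hg]
  have hy : (V *ᵥ v) y ≠ 0 := by
    rw [← hsv, hsP.mulVec_apply hxy] at hx
    exact right_ne_zero_of_mul hx
  have hTxy : T x y = s x y * T y y := by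
    conv_lhs => rw [← hsT]
    exact hsP.mulVec_apply hxy fun z => T z y
  have hTT : T * T = (Fintype.card C.stabilizer : ℂ) • T := by
    calc T * T = V * (C.stabilizerSum * (Vᴴ * V) * C.stabilizerSum) * Vᴴ := by
          simp only [hT, mul_assoc]
      _ = _ := by
          rw [hu, mul_one, C.stabilizerSum_mul C.stabilizerSum_mulVec_mem, mul_smul_comm,
            smul_mul_assoc]
  have hTH : Tᴴ = T := by
    simp [hT, Matrix.conjTranspose_mul, C.stabilizerSum_conjTranspose, mul_assoc]
  rw [hTxy]
  refine mul_ne_zero hxy fun h0 => hy ?_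
  -- As `T` is Hermitian and `T * T` is a multiple of `T`, `∑ |T y z|²` is a multiple of `T y y`. A
  -- zero there kills row `y`, although `T` scales `V *ᵥ v` by a nonzero factor and `y` is in its
  -- support.
  have hrow : ∀ z, T y z = 0 := by
    have h1 := congrFun (congrFun hTT y) y
    rw [Matrix.smul_apply, h0, smul_zero, Matrix.mul_apply] at h1
    have h2 : ∑ z, (Complex.normSq (T y z)) = 0 := by
      have : ((∑ z, (Complex.normSq (T y z)) : ℝ) : ℂ) = 0 := by
        rw [← h1]
        push_cast
        refine Finset.sum_congr rfl fun z _ => ?_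
        rw [← Complex.mul_conj]
        congr 1
        conv_rhs => rw [← hTH]
        rfl
      exact_mod_cast this
    intro z
    exact Complex.normSq_eq_zero.1
      ((Finset.sum_eq_zero_iff_of_nonneg fun z _ => Complex.normSq_nonneg _).1 h2 z
        (Finset.mem_univ z))
  have hTv : T *ᵥ (V *ᵥ v) = (Fintype.card C.stabilizer : ℂ) • (V *ᵥ v) := by
    rw [Matrix.mulVec_mulVec, hT, mul_assoc, hu, mul_one, ← Matrix.mulVec_mulVec,
      C.stabilizerSum_mulVec hv, Matrix.mulVec_smul]
  have h3 := congrFun hTv y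
  rw [Matrix.mulVec, dotProduct, Finset.sum_eq_zero fun z _ => by rw [hrow z, zero_mul],
    Pi.smul_apply, smul_eq_mul] at h3
  exact (mul_eq_zero.1 h3.symm).resolve_left C.card_stabilizer_ne_zero

/-- The phases of a diagonal factor of a logical gate differ by fourth roots of unity along
the transformed stabilizer. -/
theorem IsLogicalGate.diagonal_pow_four {V₁ V₂ : QOp n} (h₁ : IsClifford V₁) (h₂ : IsClifford V₂)
    {u : QBits n → ℂ} (hu : Matrix.diagonal u ∈ Matrix.unitaryGroup (QBits n) ℂ)
    (hV : C.IsLogicalGate (V₁ * Matrix.diagonal u * V₂))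
    {g : Matrix.unitaryGroup (QBits n) ℂ} (hg : g ∈ C.stabilizer) {v : QBits n → ℂ}
    (hv : v ∈ C.space) {x y : QBits n} (hx : (V₂ *ᵥ v) x ≠ 0)
    (hxy : (V₂ * (g : QOp n) * V₂ᴴ) x y ≠ 0) : u x ^ 4 = u y ^ 4 := by
  have hu₁ := conjTranspose_mul_self_of_mem h₁.1
  have hu₁' := mul_conjTranspose_self_of_mem h₁.1
  have hu₂ := conjTranspose_mul_self_of_mem h₂.1
  have hVu := mul_conjTranspose_self_of_mem hV.1
  have hT := conj_stabilizerSum_apply_ne_zero h₂ hg hv hx hxy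
  have hT2 : V₁ᴴ * C.stabilizerSum * V₁ =
      Matrix.diagonal u * (V₂ * C.stabilizerSum * V₂ᴴ) * (Matrix.diagonal u)ᴴ := by
    calc V₁ᴴ * C.stabilizerSum * V₁
        = V₁ᴴ * (C.stabilizerSum * (V₁ * Matrix.diagonal u * V₂)
            * (V₁ * Matrix.diagonal u * V₂)ᴴ) * V₁ := by
          rw [mul_assoc C.stabilizerSum, hVu, mul_one]
      _ = V₁ᴴ * V₁ * (Matrix.diagonal u * (V₂ * C.stabilizerSum * V₂ᴴ) * (Matrix.diagonal u)ᴴ)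
            * (V₁ᴴ * V₁) := by
          rw [← hV.commute_stabilizerSum]
          simp only [Matrix.conjTranspose_mul, mul_assoc]
      _ = _ := by rw [hu₁, one_mul, mul_one]
  have hune : ∀ z, u z ≠ 0 := by
    intro z hz
    have := congrFun (congrFun (Matrix.mem_unitaryGroup_iff.1 hu) z) z
    simp [Matrix.diagonal_mul, hz] at this
  have hT2xy : (V₁ᴴ * C.stabilizerSum * V₁) x y ≠ 0 := by
    rw [hT2, Matrix.diagonal_conjTranspose, Matrix.mul_diagonal, Matrix.diagonal_mul]
    exact mul_ne_zero (mul_ne_zero (hune x) hT) (star_ne_zero.2 (hune y))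
  obtain ⟨g', hg', ht⟩ : ∃ g' ∈ C.stabilizer, (V₁ᴴ * (g' : QOp n) * V₁) x y ≠ 0 := by
    by_contra! hcon
    refine hT2xy ?_
    rw [stabilizerSum, Finset.mul_sum, Finset.sum_mul, Matrix.sum_apply]
    exact Finset.sum_eq_zero fun g' _ => hcon g' g'.2
  have hs := InPauliGroup.conj h₂ (C.pauli g hg)
  have ht' := InPauliGroup.conj h₁.conjTranspose (C.pauli g' hg')
  rw [Matrix.conjTranspose_conjTranspose] at ht'
  have e1 : (V₂ *ᵥ v) x = (V₂ * (g : QOp n) * V₂ᴴ) x y * (V₂ *ᵥ v) y := by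
    rw [← hs.mulVec_apply hxy, Matrix.mulVec_mulVec, mul_assoc, hu₂, mul_one,
      ← Matrix.mulVec_mulVec, hv g hg]
  -- The gate keeps `v` in the code, so `diagonal u *ᵥ (V₂ *ᵥ v)` is fixed by the stabilizer
  -- conjugated by `V₁†`. Fourth powers remove the unknown Pauli entries in `e1` and `e2`.
  have e2 : (Matrix.diagonal u *ᵥ (V₂ *ᵥ v)) x =
      (V₁ᴴ * (g' : QOp n) * V₁) x y * (Matrix.diagonal u *ᵥ (V₂ *ᵥ v)) y := by
    have h3 := hV.2 v hv g' hg'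
    have h4 : (V₁ᴴ * (g' : QOp n) * V₁) *ᵥ (Matrix.diagonal u *ᵥ (V₂ *ᵥ v)) =
        Matrix.diagonal u *ᵥ (V₂ *ᵥ v) := by
      calc _ = V₁ᴴ *ᵥ ((g' : QOp n) *ᵥ ((V₁ * Matrix.diagonal u * V₂) *ᵥ v)) := by
            simp only [Matrix.mulVec_mulVec, mul_assoc]
        _ = (V₁ᴴ * V₁) *ᵥ (Matrix.diagonal u *ᵥ (V₂ *ᵥ v)) := by
            rw [h3]; simp only [Matrix.mulVec_mulVec, mul_assoc]
        _ = _ := by rw [hu₁, Matrix.one_mulVec]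
    rw [← ht'.mulVec_apply ht, h4]
  rw [Matrix.mulVec_diagonal, Matrix.mulVec_diagonal] at e2
  have e3 := congrArg (· ^ 4) e1
  have e4 := congrArg (· ^ 4) e2
  simp only [mul_pow, hs.apply_pow_four hxy, ht'.apply_pow_four ht, one_mul] at e3 e4
  rw [← e3] at e4
  exact mul_right_cancel₀ (pow_ne_zero 4 hx) e4

end StabilizerCode

/-! ### Consequences of distance at least two -/

namespace PauliString

theorem weight_le_one {p : PauliString n} {l : Fin n} (h : ∀ j, j ≠ l → p j = PauliOp.I) :
    p.weight ≤ 1 := by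
  refine (Finset.card_le_card (t := {l}) fun j hj => ?_).trans (Finset.card_singleton l).le
  simp only [Finset.mem_filter, Finset.mem_univ, true_and] at hj
  exact Finset.mem_singleton.2 (not_not.1 fun hjl => hj (h j hjl))

/-- The sign relating the two local products is also the global sign, which must be `1` as the
product is invertible. -/
theorem mat_mul_comm_of_op {p : PauliString n} {l : Fin n} {r : PauliOp}
    (h : p.op * (single l r).op = (single l r).op * p.op) :
    (p l).mat * r.mat = r.mat * (p l).mat := by
  obtain ⟨e, -, he⟩ := PauliOp.mat_mul_comm (p l) r
  have h1 := op_mul_single he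
  rw [h, ← one_smul ℂ ((single l r).op * p.op), smul_smul, mul_one] at h1
  rw [he, ← smul_left_cancel_of_mem_unitaryGroup
    (mul_mem (single l r).op_mem_unitaryGroup p.op_mem_unitaryGroup) h1, one_smul]

end PauliString

/-- A transversal Clifford operator maps `Z` operators on a single qubit to Pauli operators on that
qubit. -/
theorem IsTransversal.conj_single_Z {V : QOp n} (hT : IsTransversal V) (hV : IsClifford V)
    (l : Fin n) : ∃ (c : ℂ) (q : PauliString n), q.weight ≤ 1 ∧
      Vᴴ * (PauliString.single l PauliOp.Z).op * V = c • q.op ∧ c ≠ 0 := by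
  obtain ⟨c, hc, q, hq⟩ := hV.conjTranspose.2 (PauliString.single l PauliOp.Z)
  rw [Matrix.conjTranspose_conjTranspose] at hq
  have hc0 : c ≠ 0 := by rintro rfl; simp at hc
  refine ⟨c, q, ?_, hq, hc0⟩
  obtain ⟨u, hu, rfl⟩ := hT
  refine PauliString.weight_le_one (l := l) fun j hj => ?_
  -- By transversality the conjugate of `Z_l` is trivial on qubit `j ≠ l`, so it commutes with every
  -- Pauli there.
  have key : ∀ r, q.op * (PauliString.single j r).op = (PauliString.single j r).op * q.op := by
    intro r
    refine smul_right_injective _ hc0 ?_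
    simp only
    rw [← smul_mul_assoc, ← mul_smul_comm, ← hq]
    simp only [PauliString.op, tensorOp_conjTranspose, tensorOp_mul]
    congr 1
    ext1 i
    by_cases hi : i = j
    · subst hi
      rw [PauliString.single_of_ne hj]
      simp [PauliOp.mat, conjTranspose_mul_self_of_mem (hu i)]
    · simp [PauliString.single_of_ne hi, PauliOp.mat]
  exact PauliOp.eq_I_of_commute (PauliString.mat_mul_comm_of_op (key _))
    (PauliString.mat_mul_comm_of_op (key _))

namespace StabilizerCode

variable {C : StabilizerCode n}

/-- In a code of distance at least two, Pauli operators of weight one that commute with the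
stabilizer belong to it up to a phase. -/
theorem exists_eq_smul_of_weight_le_one (hd : 2 ≤ C.distance) {p : PauliString n}
    (hp : p.weight ≤ 1)
    (hcomm : ∀ g ∈ C.stabilizer, (g : QOp n) * p.op = p.op * (g : QOp n)) :
    ∃ g ∈ C.stabilizer, ∃ c : ℂ, p.op = c • (g : QOp n) := by
  by_contra! hcon
  have h1 : C.distance ≤ (p.weight : ℕ∞) := sInf_le ⟨p, hcomm, hcon, rfl⟩
  have h2 : ((2 : ℕ) : ℕ∞) ≤ (p.weight : ℕ∞) := hd.trans h1
  have h3 := Nat.cast_le.1 h2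
  omega

/-- With no qubits the dimension is at most one. With one qubit the code is the whole space and the
stabilizer is trivial, so `Z` would violate the distance. This keeps `log n` at least `log 2`. -/
theorem two_le_of_distance (hk : 2 ≤ Module.finrank ℂ C.space) (hd : 2 ≤ C.distance) : 2 ≤ n := by
  have hle := Submodule.finrank_le C.space
  rw [Module.finrank_fintype_fun_eq_card, Fintype.card_fun, Fintype.card_fin, Fintype.card_fin]
    at hle
  by_contra! hn
  interval_cases n
  · omega
  have htop : C.space = ⊤ := Submodule.eq_top_of_finrank_eq (by
    rw [Module.finrank_fintype_fun_eq_card, Fintype.card_fun, Fintype.card_fin, Fintype.card_fin]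
    omega)
  have hone : ∀ g ∈ C.stabilizer, (g : QOp 1) = 1 := fun g hg =>
    Matrix.ext_iff_mulVec.2 fun v => by
      rw [Matrix.one_mulVec]
      exact (htop ▸ Submodule.mem_top : v ∈ C.space) g hg
  obtain ⟨g, hg, c, h⟩ := exists_eq_smul_of_weight_le_one hd
    (p := PauliString.single 0 PauliOp.Z)
    (PauliString.weight_le_one (l := 0) fun j hj => absurd (Subsingleton.elim j 0) hj)
    (fun g hg => by rw [hone g hg, one_mul, mul_one])
  rw [hone g hg, PauliString.single_Z_op] at h
  have h0 := congrFun (congrFun h 0) 0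
  have h1 := congrFun (congrFun h 1) 1
  simp [bitSign] at h0 h1
  rw [← h0] at h1
  norm_num at h1

variable (C) in
/-- The computational basis states occurring in the image of the code space under `V`. -/
def support (V : QOp n) : Set (QBits n) := {x | ∃ v ∈ C.space, (V *ᵥ v) x ≠ 0}

/-- On the image of a code of distance at least two under a transversal Clifford operator, a
single-qubit `Z` operator that commutes with the transformed stabilizer acts as a scalar. -/
theorem bitSign_eq_of_commute (hd : 2 ≤ C.distance) {V : QOp n} (hT : IsTransversal V)
    (hV : IsClifford V) {l : Fin n}
    (h : ∀ g ∈ C.stabilizer, V * (g : QOp n) * Vᴴ * (PauliString.single l PauliOp.Z).op =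
      (PauliString.single l PauliOp.Z).op * (V * (g : QOp n) * Vᴴ))
    {x y : QBits n} (hx : x ∈ C.support V) (hy : y ∈ C.support V) :
    bitSign (x l) = bitSign (y l) := by
  have hu := conjTranspose_mul_self_of_mem hV.1
  have hu' := mul_conjTranspose_self_of_mem hV.1
  obtain ⟨c, q, hq, hcq, hc⟩ := hT.conj_single_Z hV l
  obtain ⟨g, hg, d, hgd⟩ := exists_eq_smul_of_weight_le_one hd hq fun g hg => by
    refine smul_right_injective _ hc ?_
    simp only
    rw [← mul_smul_comm, ← smul_mul_assoc, ← hcq]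
    calc (g : QOp n) * (Vᴴ * (PauliString.single l PauliOp.Z).op * V)
        = Vᴴ * (V * (g : QOp n) * Vᴴ * (PauliString.single l PauliOp.Z).op) * V := by
          simp only [← mul_assoc, hu, one_mul]
      _ = _ := by
          rw [h g hg]
          simp only [mul_assoc, hu, mul_one]
  have key : ∀ {x}, x ∈ C.support V → (bitSign (x l) : ℂ) = c * d := by
    rintro x ⟨v, hv, hx⟩
    have h1 : (PauliString.single l PauliOp.Z).op *ᵥ (V *ᵥ v) = (c * d) • (V *ᵥ v) := by
      calc _ = (V * (Vᴴ * (PauliString.single l PauliOp.Z).op * V)) *ᵥ v := by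
            simp only [Matrix.mulVec_mulVec, ← mul_assoc, hu', one_mul]
        _ = _ := by
            rw [hcq, hgd, smul_smul, ← Matrix.mulVec_mulVec, Matrix.smul_mulVec, hv g hg,
              Matrix.mulVec_smul]
    have h2 := congrFun h1 x
    rw [PauliString.single_Z_op, Matrix.mulVec_diagonal, Pi.smul_apply, smul_eq_mul] at h2
    exact mul_right_cancel₀ hx h2
  exact_mod_cast (key hx).trans (key hy).symm

/-- A linear combination of the single-qubit signs that is invariant under the stabilizer is
constant on the support of a code of distance at least two. -/
theorem sum_bitSign_eq (hd : 2 ≤ C.distance) {V : QOp n} (hT : IsTransversal V)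
    (hV : IsClifford V) (a : Fin n → ℤ)
    (hinv : ∀ g ∈ C.stabilizer, ∀ x ∈ C.support V, ∀ y, (V * (g : QOp n) * Vᴴ) x y ≠ 0 →
      ∑ l, a l * bitSign (x l) = ∑ l, a l * bitSign (y l))
    {x y : QBits n} (hx : x ∈ C.support V) (hy : y ∈ C.support V) :
    ∑ l, a l * bitSign (x l) = ∑ l, a l * bitSign (y l) := by
  have hu := conjTranspose_mul_self_of_mem hV.1
  let s : C.stabilizer → QOp n := fun g =>
    V * ((g : Matrix.unitaryGroup (QBits n) ℂ) : QOp n) * Vᴴ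
  let Z : Fin n → QOp n := fun l => (PauliString.single l PauliOp.Z).op
  have hsmul : ∀ g h, s (g * h) = s g * s h := by
    intro g h
    calc s (g * h) = V * ((g : Matrix.unitaryGroup (QBits n) ℂ) : QOp n) * (Vᴴ * V) *
          ((h : Matrix.unitaryGroup (QBits n) ℂ) : QOp n) * Vᴴ := by
          rw [hu, mul_one]; simp [s, mul_assoc]
      _ = _ := by simp only [s, mul_assoc]
  have hsu : ∀ g, s g ∈ Matrix.unitaryGroup (QBits n) ℂ := fun g =>
    mul_mul_conjTranspose_mem hV.1 g.1.2
  have hex : ∀ l g, ∃ e : ℤ, (e = 1 ∨ e = -1) ∧ s g * Z l = (e : ℂ) • (Z l * s g) := by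
    intro l g
    obtain ⟨e, he, h⟩ := (InPauliGroup.conj hV (C.pauli g g.2)).inCliffordLevel_one.mul_op_comm
      (PauliString.single l PauliOp.Z)
    rcases he with rfl | rfl
    · exact ⟨1, Or.inl rfl, by simpa using h⟩
    · exact ⟨-1, Or.inr rfl, by simpa using h⟩
  choose χ hχ hcomm using hex
  have hχmul : ∀ l g h, χ l (g * h) = χ l g * χ l h := by
    intro l g h
    have h1 : ((χ l (g * h) : ℤ) : ℂ) • (Z l * s (g * h)) =
        ((χ l g : ℂ) * (χ l h : ℂ)) • (Z l * s (g * h)) := by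
      rw [← hcomm, hsmul, mul_assoc, hcomm, mul_smul_comm, ← mul_assoc, hcomm, smul_mul_assoc,
        smul_smul, mul_assoc, mul_comm (χ l h : ℂ)]
    exact_mod_cast smul_left_cancel_of_mem_unitaryGroup
      (mul_mem (PauliString.single l PauliOp.Z).op_mem_unitaryGroup (hsu (g * h))) h1
  -- `χ l` is a character: if it takes the value `-1` at `g₀`, translation by `g₀` negates its sum;
  -- otherwise `Z_l` commutes with the transformed stabilizer.
  have hsum : ∀ l, ∑ g, χ l g = 0 ∨
      ∀ x ∈ C.support V, ∀ y ∈ C.support V, bitSign (x l) = bitSign (y l) := by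
    intro l
    by_cases hg : ∃ g, χ l g = -1
    · obtain ⟨g₀, hg₀⟩ := hg
      left
      have h1 : ∑ g, χ l g = ∑ g, -χ l g :=
        (Fintype.sum_equiv (Equiv.mulLeft g₀) _ _ fun g => by
          rw [Equiv.coe_mulLeft, hχmul, hg₀, neg_one_mul]).symm
      rw [Finset.sum_neg_distrib] at h1
      omega
    · push Not at hg
      right
      intro x hx y hy
      refine bitSign_eq_of_commute hd hT hV (fun g hgs => ?_) hx hy
      have h1 := hcomm l ⟨g, hgs⟩
      rw [(hχ l ⟨g, hgs⟩).resolve_right (hg _), Int.cast_one, one_smul] at h1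
      exact h1
  -- Each `g` links `x` to a `y` whose signs are those of `x` times `χ l g`; invariance of the sum
  -- at `y` is then added up over all `g`.
  have hav : ∀ x ∈ C.support V, Fintype.card C.stabilizer * ∑ l, a l * bitSign (x l) =
      ∑ l, a l * bitSign (x l) * ∑ g, χ l g := by
    rintro x hx
    have h1 : ∀ g, ∑ l, a l * bitSign (x l) = ∑ l, a l * bitSign (x l) * χ l g := by
      intro g
      obtain ⟨v, hv, hxv⟩ := hx
      have hsv : s g *ᵥ (V *ᵥ v) = V *ᵥ v := by
        simp only [s]
        rw [Matrix.mulVec_mulVec, mul_assoc, hu, mul_one, ← Matrix.mulVec_mulVec, hv g g.2]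
      obtain ⟨y, hy⟩ : ∃ y, s g x y ≠ 0 := by
        by_contra! hcon
        refine hxv ?_
        rw [← hsv, Matrix.mulVec, dotProduct]
        exact Finset.sum_eq_zero fun z _ => by rw [hcon z, zero_mul]
      rw [hinv g g.2 x ⟨v, hv, hxv⟩ y hy]
      refine Finset.sum_congr rfl fun l _ => ?_
      have h2 := congrFun (congrFun (hcomm l g) x) y
      simp only [Z] at h2
      rw [PauliString.single_Z_op, Matrix.mul_diagonal, Matrix.smul_apply, Matrix.diagonal_mul,
        smul_eq_mul, ← mul_assoc, mul_comm] at h2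
      have h3 : bitSign (y l) = χ l g * bitSign (x l) := by
        exact_mod_cast mul_right_cancel₀ hy h2
      rw [h3]; ring
    calc (Fintype.card C.stabilizer : ℤ) * ∑ l, a l * bitSign (x l)
        = ∑ _g : C.stabilizer, ∑ l, a l * bitSign (x l) := by simp
      _ = ∑ g, ∑ l, a l * bitSign (x l) * χ l g := Finset.sum_congr rfl fun g _ => h1 g
      _ = _ := by rw [Finset.sum_comm]; simp only [Finset.mul_sum]
  have hN : (Fintype.card C.stabilizer : ℤ) ≠ 0 := Nat.cast_ne_zero.2 Fintype.card_ne_zero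
  refine mul_left_cancel₀ hN ?_
  rw [hav x hx, hav y hy]
  refine Finset.sum_congr rfl fun l _ => ?_
  rcases hsum l with h | h
  · rw [h, mul_zero, mul_zero]
  · rw [h x hx y hy]

/-- If the denominator is large compared to the numerators, then the diagonal factor of a logical
gate acts trivially. -/
theorem IsLogicalGate.zRotations_trivial (hd : 2 ≤ C.distance) {V₁ V₂ : QOp n}
    (h₁ : IsClifford V₁) (hT₂ : IsTransversal V₂) (h₂ : IsClifford V₂) {a : Fin n → ℤ} {D A : ℕ}
    (ha : ∀ l, (a l).natAbs ≤ A) (hD : 8 * (n * A) < D)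
    (hV : C.IsLogicalGate (V₁ * zRotations a D * V₂)) :
    ∃ c : ℂ, ∀ v ∈ C.space, zRotations a D *ᵥ (V₂ *ᵥ v) = c • (V₂ *ᵥ v) := by
  have hD0 : (D : ℂ) ≠ 0 := Nat.cast_ne_zero.2 (by omega)
  have hU := zRotations_mem_unitaryGroup a D
  rw [zRotations_eq_diagonal] at hV hU ⊢
  have hf : ∀ x : QBits n, |∑ l, a l * bitSign (x l)| ≤ n * A := by
    intro x
    refine (Finset.abs_sum_le_sum_abs _ _).trans ?_
    calc ∑ l, |a l * bitSign (x l)| ≤ ∑ _l : Fin n, (A : ℤ) := by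
          refine Finset.sum_le_sum fun l _ => ?_
          have hb : |bitSign (x l)| = 1 := by unfold bitSign; split_ifs <;> simp
          rw [abs_mul, hb, mul_one, Int.abs_eq_natAbs]
          exact_mod_cast ha l
      _ = n * A := by simp
  have hinv : ∀ g ∈ C.stabilizer, ∀ x ∈ C.support V₂, ∀ y, (V₂ * (g : QOp n) * V₂ᴴ) x y ≠ 0 →
      ∑ l, a l * bitSign (x l) = ∑ l, a l * bitSign (y l) := by
    rintro g hg x ⟨v, hv, hx⟩ y hxy
    have h := hV.diagonal_pow_four h₁ h₂ hU hg hv hx hxy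
    rw [← Complex.exp_nat_mul, ← Complex.exp_nat_mul, Complex.exp_eq_exp_iff_exists_int] at h
    obtain ⟨k, hk⟩ := h
    have hx' := hf x
    have hy' := hf y
    generalize ∑ l, a l * bitSign (x l) = fx at hk hx' ⊢
    generalize ∑ l, a l * bitSign (y l) = fy at hk hy' ⊢
    have h4 : 4 * (fy - fx) = k * D := by
      have hpi : (Real.pi : ℂ) ≠ 0 := Complex.ofReal_ne_zero.2 Real.pi_ne_zero
      have hc : 2 * Real.pi * Complex.I * (4 * ((fy : ℂ) - fx)) =
          2 * Real.pi * Complex.I * (k * D) := by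
        push_cast at hk
        field_simp at hk
        linear_combination (2 * Real.pi * Complex.I) * hk
      exact_mod_cast mul_left_cancel₀ Complex.two_pi_I_ne_zero hc
    -- Both values are at most `n * A` in absolute value, whence the constant `8 = 4 * 2`; a
    -- multiple of `D` below `D` in absolute value vanishes.
    have hlt : |4 * (fy - fx)| < D := by
      have hD' : 8 * ((n : ℤ) * A) < D := by exact_mod_cast hD
      rw [abs_le] at hx' hy'
      rw [abs_lt]
      constructor <;> linarith
    have := Int.eq_zero_of_abs_lt_dvd ⟨k, by rw [h4, mul_comm]⟩ hlt
    omega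
  by_cases hne : (C.support V₂).Nonempty
  · obtain ⟨x₀, hx₀⟩ := hne
    refine ⟨Complex.exp (-Complex.I * 2 * Real.pi / D *
      ((∑ l, a l * bitSign (x₀ l) : ℤ) : ℂ)), fun v hv => funext fun x => ?_⟩
    rw [Matrix.mulVec_diagonal, Pi.smul_apply, smul_eq_mul]
    by_cases hx : (V₂ *ᵥ v) x = 0
    · rw [hx, mul_zero, mul_zero]
    · rw [sum_bitSign_eq hd hT₂ h₂ a hinv ⟨v, hv, hx⟩ hx₀]
  · refine ⟨0, fun v hv => ?_⟩
    have h0 : V₂ *ᵥ v = 0 := funext fun x => not_not.1 fun hx => hne ⟨x, v, hv, hx⟩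
    rw [h0, Matrix.mulVec_zero, smul_zero]

/-! ### Logical operators -/

variable {k : ℕ} {W : Matrix (QBits n) (QBits k) ℂ}

theorem IsEncoding.mul_left_cancel (hW : C.IsEncoding W) {A B : QOp k} (h : W * A = W * B) :
    A = B := by
  rw [← one_mul A, ← one_mul B, ← hW.1, Matrix.mul_assoc, h, Matrix.mul_assoc]

theorem IsEncoding.mulVec_mem (hW : C.IsEncoding W) (v : QBits k → ℂ) : W *ᵥ v ∈ C.space :=
  hW.2.1 ▸ LinearMap.mem_range_self W.mulVecLin v

/-- `W * Wᴴ` fixes the code space, which contains the range of `V * W`. -/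
theorem IsLogicalGate.exists_implements (hW : C.IsEncoding W) {V : QOp n}
    (hV : C.IsLogicalGate V) : ∃ VL : QOp k, Implements W V VL := by
  refine ⟨Wᴴ * (V * W), Matrix.ext_iff_mulVec.2 fun v => ?_⟩
  have h := hV.2 _ (hW.mulVec_mem v)
  rw [← hW.2.1] at h
  obtain ⟨w, hw⟩ := h
  rw [Matrix.mulVecLin_apply, Matrix.mulVec_mulVec] at hw
  rw [← Matrix.mulVec_mulVec v W, ← Matrix.mulVec_mulVec v Wᴴ, ← hw, Matrix.mulVec_mulVec _ Wᴴ,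
    hW.1, Matrix.one_mulVec]

theorem IsEncoding.mem_unitaryGroup (hW : C.IsEncoding W) {V : QOp n} {VL : QOp k}
    (hV : V ∈ Matrix.unitaryGroup (QBits n) ℂ) (h : Implements W V VL) :
    VL ∈ Matrix.unitaryGroup (QBits k) ℂ := by
  rw [Matrix.mem_unitaryGroup_iff', Matrix.star_eq_conjTranspose]
  have h' : V * W = W * VL := h
  calc VLᴴ * VL = (W * VL)ᴴ * (W * VL) := by
        rw [Matrix.conjTranspose_mul, Matrix.mul_assoc, ← Matrix.mul_assoc Wᴴ, hW.1,
          Matrix.one_mul]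
    _ = Wᴴ * (Vᴴ * V * W) := by
        rw [← h', Matrix.conjTranspose_mul]; simp only [Matrix.mul_assoc]
    _ = 1 := by rw [conjTranspose_mul_self_of_mem hV, Matrix.one_mul, hW.1]

theorem IsEncoding.norm_eq_one (hW : C.IsEncoding W) {V : QOp n} {VL : QOp k} {c : ℂ}
    (hV : V ∈ Matrix.unitaryGroup (QBits n) ℂ) (hL : VL ∈ Matrix.unitaryGroup (QBits k) ℂ)
    (h : W * VL = c • (V * W)) : ‖c‖ = 1 := by
  have h1 : (W * VL)ᴴ * (W * VL) = 1 := by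
    rw [Matrix.conjTranspose_mul, Matrix.mul_assoc, ← Matrix.mul_assoc Wᴴ, hW.1, Matrix.one_mul,
      conjTranspose_mul_self_of_mem hL]
  have h2 : (V * W)ᴴ * (V * W) = 1 := by
    rw [Matrix.conjTranspose_mul, Matrix.mul_assoc, ← Matrix.mul_assoc Vᴴ,
      conjTranspose_mul_self_of_mem hV, Matrix.one_mul, hW.1]
  refine norm_eq_one_of_smul_mem_unitaryGroup (one_mem (Matrix.unitaryGroup (QBits k) ℂ)) ?_
  rw [h, Matrix.conjTranspose_smul, Matrix.smul_mul, Matrix.mul_smul, h2, smul_smul] at h1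
  rw [Matrix.mem_unitaryGroup_iff', star_smul, star_one, smul_mul_smul_comm, one_mul, h1]

/-- A logical operator implemented by a physical operator in some level of the Clifford hierarchy
is in that level as well. -/
theorem IsEncoding.inCliffordLevel (hW : C.IsEncoding W) {j : ℕ} {V : QOp n} {VL : QOp k}
    (hV : InCliffordLevel j V) (h : Implements W V VL) : InCliffordLevel j VL := by
  induction j generalizing V VL with
  | zero => exact hV.elim
  | succ j ih =>
    have hVu := hV.mem_unitaryGroup
    have hL := hW.mem_unitaryGroup hVu h
    have h' : V * W = W * VL := h
    cases j with
    | zero =>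
      -- At level one, the signs of `V` against the physical representatives of logical Paulis
      -- become the signs of `VL`.
      refine inCliffordLevel_one_of_mul_comm hL fun q => ?_
      obtain ⟨P, ⟨c, -, r, rfl⟩, hP⟩ := hW.2.2 q
      obtain ⟨e, he, hr⟩ := hV.mul_op_comm r
      refine ⟨e, he, hW.mul_left_cancel ?_⟩
      calc W * (VL * q.op) = V * (W * q.op) := by
            rw [← Matrix.mul_assoc, ← h', Matrix.mul_assoc]
        _ = V * (c • r.op) * W := by rw [← hP, Matrix.mul_assoc]
        _ = e • (c • r.op * (V * W)) := by
            rw [mul_smul_comm, hr, smul_comm, Matrix.smul_mul, ← smul_mul_assoc, Matrix.mul_assoc]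
        _ = W * (e • (q.op * VL)) := by
            rw [h', ← Matrix.mul_assoc, hP, Matrix.mul_smul, Matrix.mul_assoc]
    | succ j =>
      refine ⟨hL, fun q => ?_⟩
      obtain ⟨P, ⟨c, hc, r, rfl⟩, hP⟩ := hW.2.2 q
      have hc1 : ‖c‖ = 1 := (pow_eq_one_iff_of_nonneg (norm_nonneg c) four_ne_zero).1
        (by rw [← norm_pow, hc, norm_one])
      refine ih ((hV.2 r).smul hc1) ?_
      have hVW : Vᴴ * W = W * VLᴴ := by
        calc Vᴴ * W = Vᴴ * (W * VL) * VLᴴ := by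
              rw [← Matrix.mul_assoc, Matrix.mul_assoc _ VL, mul_conjTranspose_self_of_mem hL,
                Matrix.mul_one]
          _ = _ := by
              rw [← h', ← Matrix.mul_assoc, conjTranspose_mul_self_of_mem hVu, Matrix.one_mul]
      calc c • (V * r.op * Vᴴ) * W = V * ((c • r.op) * W) * VLᴴ := by
            rw [Matrix.smul_mul, Matrix.mul_assoc, hVW]
            simp only [Matrix.smul_mul, Matrix.mul_smul, Matrix.mul_assoc]
        _ = W * (VL * q.op * VLᴴ) := by
            rw [hP, ← Matrix.mul_assoc, h']; simp only [Matrix.mul_assoc]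

end StabilizerCode

/-- Powers of two below a polynomial bound have logarithmic exponents. -/
theorem exists_exponent_le_log (q : Polynomial ℕ) :
    ∃ K : ℝ, 0 ≤ K ∧ ∀ n m : ℕ, 2 ≤ n → 2 ^ m ≤ q.eval n → (m : ℝ) ≤ K * Real.log n := by
  have hl2 : 0 < Real.log 2 := Real.log_pos one_lt_two
  have hq0 : 0 ≤ Real.log (q.eval 1 : ℕ) := Real.log_natCast_nonneg _
  -- From `2 ^ m ≤ q(1) n ^ deg q`, `m log 2 ≤ log q(1) + deg q * log n`. Since `n ≥ 2`, the
  -- constant `log q(1)` is absorbed at the price of a factor `log n / log 2`.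
  refine ⟨(Real.log (q.eval 1 : ℕ) / Real.log 2 + q.natDegree) / Real.log 2, by positivity,
    fun n m hn hm => ?_⟩
  have hle : q.eval n ≤ q.eval 1 * n ^ q.natDegree := by
    rw [Polynomial.eval_eq_sum_range, Polynomial.eval_eq_sum_range, Finset.sum_mul]
    refine Finset.sum_le_sum fun i hi => ?_
    rw [one_pow, mul_one]
    exact Nat.mul_le_mul_left _ (Nat.pow_le_pow_right (by omega)
      (Nat.lt_succ_iff.1 (Finset.mem_range.1 hi)))
  have hn0 : (0 : ℝ) < n := by exact_mod_cast (by omega : 0 < n)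
  have hq1 : (0 : ℝ) < (q.eval 1 : ℕ) := by
    have : 0 < q.eval 1 * n ^ q.natDegree := (pow_pos two_pos m).trans_le (hm.trans hle)
    exact_mod_cast Nat.pos_of_mul_pos_right this
  have hln : Real.log 2 ≤ Real.log n := Real.log_le_log two_pos (by exact_mod_cast hn)
  have h1 : (2 : ℝ) ^ m ≤ (q.eval 1 : ℕ) * (n : ℝ) ^ q.natDegree := by
    exact_mod_cast hm.trans hle
  have h2 := Real.log_le_log (by positivity) h1
  rw [Real.log_mul hq1.ne' (by positivity), Real.log_pow, Real.log_pow] at h2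
  have h3 : Real.log (q.eval 1 : ℕ) ≤ Real.log (q.eval 1 : ℕ) / Real.log 2 * Real.log n := by
    rw [div_mul_eq_mul_div, le_div_iff₀ hl2]
    exact mul_le_mul_of_nonneg_left hln hq0
  rw [div_mul_eq_mul_div, le_div_iff₀ hl2, add_mul]
  linarith

theorem corollary17 (p : Polynomial ℕ) :
    ∃ (q : Polynomial ℕ) (K : ℝ),
      ∀ (n : ℕ) (C : StabilizerCode n), 2 ≤ Module.finrank ℂ C.space → 2 ≤ C.distance →
      ∀ (V₁ V₂ : QOp n), IsTransversal V₁ → IsClifford V₁ → IsTransversal V₂ → IsClifford V₂ →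
      ∀ (m D : ℕ), D = 2 ^ m →
      ∀ (a : Fin n → ℤ), (∀ l, (a l).natAbs ≤ p.eval n) →
      C.IsLogicalGate (V₁ * zRotations a D * V₂) →
        ((¬ ∃ c : ℂ, ∀ v ∈ C.space, zRotations a D *ᵥ (V₂ *ᵥ v) = c • (V₂ *ᵥ v)) →
          D ≤ q.eval n) ∧
        ∃ j : ℕ, 1 ≤ j ∧ (j : ℝ) ≤ K * Real.log n ∧
          ∀ (k : ℕ) (W : Matrix (QBits n) (QBits k) ℂ), C.IsEncoding W →
            ∃ VL : QOp k, StabilizerCode.Implements W (V₁ * zRotations a D * V₂) VL ∧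
              InCliffordLevel j VL := by
  set q : Polynomial ℕ := 8 * (Polynomial.X * p) with hq
  have hqe : ∀ n, q.eval n = 8 * (n * p.eval n) := fun n => by simp [hq]
  obtain ⟨K, hK0, hK⟩ := exists_exponent_le_log q
  have hl2 : 0 < Real.log 2 := Real.log_pos one_lt_two
  -- For `n ≥ 2` the term `2 / log 2` pays for the additive 2 in level `m + 2`, and for level 2 in
  -- the scalar case.
  refine ⟨q, K + 2 / Real.log 2, ?_⟩
  rintro n C hk hd V₁ V₂ - h₁ hT₂ h₂ m D rfl a ha hV
  have hn := StabilizerCode.two_le_of_distance hk hd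
  have hln : Real.log 2 ≤ Real.log n := Real.log_le_log two_pos (by exact_mod_cast hn)
  have h2 : (2 : ℝ) ≤ 2 / Real.log 2 * Real.log n := by
    rw [div_mul_eq_mul_div, le_div_iff₀ hl2]
    exact mul_le_mul_of_nonneg_left hln zero_le_two
  have hbound : (¬ ∃ c : ℂ, ∀ v ∈ C.space, zRotations a (2 ^ m) *ᵥ (V₂ *ᵥ v) = c • (V₂ *ᵥ v)) →
      2 ^ m ≤ q.eval n := by
    intro h
    by_contra! hlt
    rw [hqe] at hlt
    exact h (hV.zRotations_trivial hd h₁ hT₂ h₂ ha hlt)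
  refine ⟨hbound, ?_⟩
  by_cases htriv : ∃ c : ℂ, ∀ v ∈ C.space, zRotations a (2 ^ m) *ᵥ (V₂ *ᵥ v) = c • (V₂ *ᵥ v)
  · obtain ⟨c, hc⟩ := htriv
    have hK' : 0 ≤ K * Real.log n := mul_nonneg hK0 (hl2.le.trans hln)
    refine ⟨2, by norm_num, by rw [add_mul]; push_cast; linarith, fun k W hW => ?_⟩
    obtain ⟨VL, hVL⟩ := hV.exists_implements hW
    refine ⟨VL, hVL, ?_⟩
    have heq : V₁ * zRotations a (2 ^ m) * V₂ * W = c • (V₁ * V₂ * W) :=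
      Matrix.ext_iff_mulVec.2 fun v => by
        have := congrArg (V₁ *ᵥ ·) (hc _ (hW.mulVec_mem v))
        simpa only [Matrix.mulVec_mulVec, Matrix.mulVec_smul, Matrix.smul_mulVec,
          Matrix.mul_assoc] using this
    rw [show _ = W * VL from hVL] at heq
    have hL := hW.mem_unitaryGroup hV.1 hVL
    have h12 := h₁.mul h₂
    -- The scalar `c` has norm one because both sides of `heq` are isometries, so `c • (V₁ * V₂)` is
    -- a Clifford operator implementing the same `VL`.
    refine hW.inCliffordLevel (h12.smul (hW.norm_eq_one h12.1 hL heq)) ?_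
    exact (Matrix.smul_mul _ _ _).trans heq.symm
  · refine ⟨m + 2, by omega, ?_, fun k W hW => ?_⟩
    · have := hK n m hn (hbound htriv)
      rw [add_mul]; push_cast; linarith
    · obtain ⟨VL, hVL⟩ := hV.exists_implements hW
      exact ⟨VL, hVL, hW.inCliffordLevel
        (InCliffordLevel.clifford_mul_mul h₁ h₂ (inCliffordLevel_zRotations m a)) hVL⟩
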